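/- Let $\Gamma$ and $\Sigma$ be finite simple graphs with vertex sets $V_\Gamma$ and $V_\Sigma$, and let $\{G_u\}_{u\in V_\Gamma}$ and $\{H_s\}_{s\in V_\Sigma}$ be families of primary cyclic groups, that is, each vertex group is cyclic of order $p^k$ for some prime $p$ and some $k\ge 1$ (both may depend on the vertex). Fix a generator of each vertex group and denote it by the vertex itself. Let $W(\Gamma)$ be the graph product: the quotient of the free product of the groups $G_u$ by the relations that make $G_u$ and $G_{u'}$ commute elementwise whenever $u,u'$ are adjacent in $\Gamma$; define $W(\Sigma)$ likewise. A word in the alphabet $V_\Sigma^{\pm1}$ is reduced if no shorter word defines the same element of $W(\Sigma)$. For $g\in W(\Sigma)$ let $\operatorname{supp}(g)$ be the set of $s\in V_\Sigma$ such that $s$ or $s^{-1}$ appears in some reduced word for $g$, and let the cyclic support of $g$ be $$\operatorname{csupp}(g)=\{s\in V_\Sigma \mid s\in\operatorname{supp}(wgw^{-1})\text{ for all } w\in W(\Sigma)\}.$$ If $\tau\colon W(\Gamma)\to W(\Sigma)$ is a group isomorphism, then there is a labeled-graph isomorphism $t$ from $(\Gamma,\{G_u\})$ to $(\Sigma,\{H_s\})$,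 that is, a bijection $t\colon V_\Gamma\to V_\Sigma$ such that $u,v$ are adjacent in $\Gamma$ if and only if $t(u),t(v)$ are adjacent in $\Sigma$, and $G_u\cong H_{t(u)}$ for every $u\in V_\Gamma$, with $$t(u)\in\operatorname{csupp}(\tau(u))\quad\text{for every } u\in V_\Gamma.$$ -/

import Mathlib

namespace GraphProd

/-- The relators of the graph product: commutators of elements of vertex groups
at adjacent vertices, inside the free product of the vertex groups. -/
def relators {V : Type*} (Γ : SimpleGraph V) (G : V → Type*) [∀ v, Group (G v)] :
    Set (Monoid.CoprodI G) :=
  {x | ∃ u v : V, Γ.Adj u v ∧ ∃ (g : G u) (h : G v),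
    x = Monoid.CoprodI.of g * Monoid.CoprodI.of h *
      (Monoid.CoprodI.of g)⁻¹ * (Monoid.CoprodI.of h)⁻¹}

/-- The graph product `W(Γ, G)`: the quotient of the free product of the vertex groups
by the relations making the vertex groups at adjacent vertices commute. -/
def GraphProduct {V : Type*} (Γ : SimpleGraph V) (G : V → Type*) [∀ v, Group (G v)] :=
  Monoid.CoprodI G ⧸ Subgroup.normalClosure (relators Γ G)

instance {V : Type*} (Γ : SimpleGraph V) (G : V → Type*) [∀ v, Group (G v)] :
    Group (GraphProduct Γ G) :=
  inferInstanceAs (Group (Monoid.CoprodI G ⧸ Subgroup.normalClosure (relators Γ G)))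

/-- The natural homomorphism of a vertex group into the graph product. -/
def GraphProduct.of {V : Type*} (Γ : SimpleGraph V) (G : V → Type*) [∀ v, Group (G v)]
    (v : V) : G v →* GraphProduct Γ G :=
  (QuotientGroup.mk' (Subgroup.normalClosure (relators Γ G))).comp
    (Monoid.CoprodI.of : G v →* Monoid.CoprodI G)

section Support

variable {V : Type*} (Γ : SimpleGraph V) (G : V → Type*) [∀ v, Group (G v)] (x : ∀ v, G v)

/-- The element of the graph product defined by a word in the alphabet `V^{±1}`, where the
vertex `v` stands for the chosen element `x v` of its vertex group; the letter `(v, true)`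
is `v` and the letter `(v, false)` is `v⁻¹`. -/
def wordValue (w : List (V × Bool)) : GraphProduct Γ G :=
  (w.map fun l => if l.2 then GraphProduct.of Γ G l.1 (x l.1)
    else (GraphProduct.of Γ G l.1 (x l.1))⁻¹).prod

/-- A word is reduced if no shorter word defines the same element. -/
def IsReducedWord (w : List (V × Bool)) : Prop :=
  ∀ w' : List (V × Bool), wordValue Γ G x w' = wordValue Γ G x w → w.length ≤ w'.length

/-- The vertices `u` such that `u` or `u⁻¹` appears in some reduced word for `g`. -/
def support (g : GraphProduct Γ G) : Set V :=
  {u | ∃ w : List (V × Bool), IsReducedWord Γ G x w ∧ wordValue Γ G x w = g ∧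
    ((u, true) ∈ w ∨ (u, false) ∈ w)}

/-- The vertices that lie in the support of every conjugate of `g`. -/
def cyclicSupport (g : GraphProduct Γ G) : Set V :=
  {u | ∀ a : GraphProduct Γ G, u ∈ support Γ G x (a * g * a⁻¹)}

end Support

end GraphProd

/-! A nontrivial projection of `τ(u)` to a vertex group `H s` survives conjugation and forces `s`
into the cyclic support. So it suffices to find a bijection `t`, preserving orders and adjacency,
such that `τ(u)` projects nontrivially to `t(u)`. For each prime power `p ^ k`, restrict the map
that `τ` induces on products of vertex groups to the vertices of order `p ^ k`, modulo `p`. Other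
orders contribute nothing modulo `p`, so the blocks for `τ` and `τ⁻¹` are inverse matrices
(`blockMatrix_mul_eq_one`), and a nonzero term of the determinant gives `t` on that block. Torsion
elements of a free product are conjugate into a factor, so a torsion element of a graph product
cannot project nontrivially to two nonadjacent vertices. Applied to the images of `u`, `v` and `uv`,
this shows that `t` preserves adjacency (`eq_or_adj_of_commute`). The converse follows from the same
result for `τ⁻¹` and finiteness. -/

namespace Monoid.CoprodI

/-! ### Torsion in free products -/

variable {ι : Type*} {M : ι → Type*} [∀ i, Group (M i)]

/-- The product in the free product of a list of letters, not necessarily reduced. -/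
def listProd (l : List (Σ i, M i)) : CoprodI M := (l.map fun a => of a.2).prod

theorem listProd_append (l l' : List (Σ i, M i)) :
    listProd (l ++ l') = listProd l * listProd l' := by simp [listProd]

theorem listProd_cons (a : Σ i, M i) (l : List (Σ i, M i)) :
    listProd (a :: l) = of a.2 * listProd l := by simp [listProd]

theorem exists_listProd_eq (g : CoprodI M) : ∃ l : List (Σ i, M i), listProd l = g := by
  induction g using CoprodI.induction_on with
  | one => exact ⟨[], rfl⟩
  | of i m => exact ⟨[⟨i, m⟩], by simp [listProd]⟩
  | mul g h hg hh =>
    obtain ⟨l, rfl⟩ := hg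
    obtain ⟨l', rfl⟩ := hh
    exact ⟨l ++ l', listProd_append _ _⟩

theorem listProd_replicate_flatten (n : ℕ) (l : List (Σ i, M i)) :
    listProd (List.replicate n l).flatten = listProd l ^ n := by
  induction n with
  | zero => simp [listProd]
  | succ n ih => rw [List.replicate_succ, List.flatten_cons, listProd_append, ih, pow_succ']

theorem isConj_listProd_rotate {g : CoprodI M} {l l' : List (Σ i, M i)}
    (h : IsConj g (listProd (l ++ l'))) : IsConj g (listProd (l' ++ l)) := by
  refine h.trans (isConj_iff.2 ⟨(listProd l)⁻¹, ?_⟩)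
  simp only [listProd_append]
  group

theorem eq_nil_of_listProd_eq_one {l : List (Σ i, M i)} (h1 : ∀ a ∈ l, a.2 ≠ 1)
    (h2 : l.IsChain fun a b => a.1 ≠ b.1) (h : listProd l = 1) : l = [] := by
  classical
  have : (⟨l, h1, h2⟩ : Word M) = Word.empty := by
    apply Word.equiv.symm.injective
    exact h
  exact congrArg Word.toList this

/-- An element of finite order of a free product is conjugate to a word with at most one letter. -/
theorem exists_isConj_listProd_of_isOfFinOrder {g : CoprodI M} (hg : IsOfFinOrder g) :
    ∃ l : List (Σ i, M i), l.length ≤ 1 ∧ IsConj g (listProd l) := by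
  classical
  have hex : ∃ n, ∃ l : List (Σ i, M i), l.length = n ∧ IsConj g (listProd l) := by
    obtain ⟨l, rfl⟩ := exists_listProd_eq g
    exact ⟨_, l, rfl, IsConj.refl _⟩
  obtain ⟨l, hl, hgl⟩ := Nat.find_spec hex
  have hmin : ∀ l' : List (Σ i, M i), IsConj g (listProd l') → l.length ≤ l'.length :=
    fun l' h' => hl ▸ Nat.find_min' hex ⟨l', rfl, h'⟩
  by_contra! hcon
  have hlen : 1 < l.length := by
    by_contra! h
    exact hcon l h hgl
  have hletter : ∀ a ∈ l, a.2 ≠ 1 := by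
    intro a ha h1
    obtain ⟨s, t, rfl⟩ := List.append_of_mem ha
    have := hmin (s ++ t) (by
      rwa [listProd_append, listProd_cons, h1, map_one, one_mul, ← listProd_append] at hgl)
    simp at this
  -- Two leading letters from one factor would merge, giving a shorter conjugate; rotation brings
  -- any cyclically adjacent pair to the front.
  have hadj : ∀ (a b : Σ i, M i) (r : List (Σ i, M i)), IsConj g (listProd (a :: b :: r)) →
      (a :: b :: r).length = l.length → a.1 ≠ b.1 := by
    rintro ⟨i, a⟩ ⟨j, b⟩ r hr hlr (rfl : i = j)
    have := hmin (⟨i, a * b⟩ :: r) (by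
      simpa only [listProd_cons, map_mul, mul_assoc] using hr)
    simp only [List.length_cons] at this hlr
    omega
  have hchain : l.IsChain fun a b => a.1 ≠ b.1 := by
    rw [List.isChain_iff_forall_rel_of_append_cons_cons]
    rintro a b s t rfl
    exact hadj a b (t ++ s) (isConj_listProd_rotate hgl) (by simp; omega)
  have hends : ∀ a ∈ l.getLast?, ∀ b ∈ l.head?, a.1 ≠ b.1 := by
    intro a ha b hb
    obtain ⟨c, d, r, hcd⟩ : ∃ c d r, l = c :: d :: r := by
      match l, hlen with
      | c :: d :: r, _ => exact ⟨c, d, r, rfl⟩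
    obtain ⟨r', hr'⟩ : ∃ r', d :: r = r' ++ [a] := by
      rw [hcd, List.getLast?_cons_cons] at ha
      exact ⟨_, (List.dropLast_append_getLast? _ ha).symm⟩
    obtain rfl : c = b := by simpa [hcd] using hb
    rw [hr'] at hcd
    refine hadj a c r' ?_ (by simp [hcd])
    rw [hcd] at hgl
    exact isConj_listProd_rotate (l := c :: r') (l' := [a]) hgl
  obtain ⟨n, hn, hgn⟩ := isOfFinOrder_iff_pow_eq_one.1 hg
  -- As `l` is cyclically reduced, its powers are reduced words, so none with positive exponent is
  -- trivial.
  have hone : listProd (List.replicate n l).flatten = 1 := by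
    rw [listProd_replicate_flatten]
    obtain ⟨c, hc⟩ := isConj_iff.1 hgl
    rw [← hc, conj_pow, hgn]
    simp
  have hnil := eq_nil_of_listProd_eq_one ?_ ?_ hone
  · have := congrArg List.length hnil
    simp only [List.length_flatten, List.map_replicate, List.sum_replicate, smul_eq_mul,
      List.length_nil, mul_eq_zero] at this
    omega
  · intro a ha
    obtain ⟨l', hl', ha'⟩ := List.mem_flatten.1 ha
    exact hletter a (List.eq_of_mem_replicate hl' ▸ ha')
  · have hne : l ≠ [] := by rintro rfl; simp at hlen
    rw [List.isChain_flatten (fun h => hne (List.eq_of_mem_replicate h).symm)]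
    exact ⟨fun l' h => List.eq_of_mem_replicate h ▸ hchain,
      List.isChain_replicate_of_rel _ hends⟩

end Monoid.CoprodI

/-! ### Projections of graph products -/

namespace GraphProd

variable {V : Type*} {Γ : SimpleGraph V} {G : V → Type*} [∀ v, Group (G v)]

namespace GraphProduct

/-- The homomorphism out of a graph product given by homomorphisms out of the vertex groups
whose images commute along the edges. -/
def lift {N : Type*} [Group N] (f : ∀ v, G v →* N)
    (hf : ∀ u v, Γ.Adj u v → ∀ g h, Commute (f u g) (f v h)) : GraphProduct Γ G →* N :=
  QuotientGroup.lift (Subgroup.normalClosure (relators Γ G)) (Monoid.CoprodI.lift f) (by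
    apply Subgroup.normalClosure_le_normal
    rintro _ ⟨u, v, huv, g, h, rfl⟩
    have := (hf u v huv g h).eq
    simp [MonoidHom.mem_ker, this])

@[simp]
theorem lift_of {N : Type*} [Group N] (f : ∀ v, G v →* N)
    (hf : ∀ u v, Γ.Adj u v → ∀ g h, Commute (f u g) (f v h)) (v : V) (g : G v) :
    lift f hf (of Γ G v g) = f v g :=
  (QuotientGroup.lift_mk _ _ _).trans (Monoid.CoprodI.lift_of f g)

theorem hom_ext {N : Type*} [Monoid N] {f f' : GraphProduct Γ G →* N}
    (h : ∀ v g, f (of Γ G v g) = f' (of Γ G v g)) : f = f' := by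
  refine QuotientGroup.monoidHom_ext _ (Monoid.CoprodI.ext_hom _ _ fun v => ?_)
  ext g
  exact h v g

theorem commute_of {u v : V} (huv : Γ.Adj u v) (g : G u) (h : G v) :
    Commute (of Γ G u g) (of Γ G v h) := by
  have hmem : Monoid.CoprodI.of g * Monoid.CoprodI.of h * (Monoid.CoprodI.of g)⁻¹ *
      (Monoid.CoprodI.of h)⁻¹ ∈ Subgroup.normalClosure (relators Γ G) :=
    Subgroup.subset_normalClosure ⟨u, v, huv, g, h, rfl⟩
  have h1 := (QuotientGroup.eq_one_iff _).2 hmem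
  have h2 : of Γ G u g * of Γ G v h * (of Γ G u g)⁻¹ * (of Γ G v h)⁻¹ = 1 := h1
  exact mul_inv_eq_iff_eq_mul.1 (mul_inv_eq_one.1 h2)

open Classical in
/-- The projection of a graph product onto the direct product of its vertex groups. -/
noncomputable def toPi (Γ : SimpleGraph V) (G : V → Type*) [∀ v, Group (G v)] :
    GraphProduct Γ G →* ∀ v, G v :=
  lift (fun v => MonoidHom.mulSingle G v)
    (fun _ _ huv g h => Pi.mulSingle_commute huv.ne g h)

/-- The projection of a graph product onto one of its vertex groups. -/
noncomputable def proj (Γ : SimpleGraph V) (G : V → Type*) [∀ v, Group (G v)] (v : V) :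
    GraphProduct Γ G →* G v :=
  (Pi.evalMonoidHom G v).comp (toPi Γ G)

open Classical in
theorem toPi_of (u : V) (g : G u) : toPi Γ G (of Γ G u g) = Pi.mulSingle u g := by
  unfold toPi
  exact lift_of _ _ u g

open Classical in
theorem proj_of (u v : V) (g : G u) : proj Γ G v (of Γ G u g) = Pi.mulSingle u g v :=
  congrFun (toPi_of (Γ := Γ) u g) v

@[simp]
theorem proj_of_self (v : V) (g : G v) : proj Γ G v (of Γ G v g) = g := by
  simp [proj_of]

theorem proj_of_ne {u v : V} (h : v ≠ u) (g : G u) : proj Γ G v (of Γ G u g) = 1 := by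
  simp [proj_of, h]

/-- A homomorphism to a commutative group factors through the projections to the
vertex groups. -/
theorem map_eq_prod_proj [Fintype V] {A : Type*} [CommGroup A] (f : GraphProduct Γ G →* A)
    (g : GraphProduct Γ G) : f g = ∏ v, f (of Γ G v (proj Γ G v g)) := by
  let f' : GraphProduct Γ G →* A := ∏ v, f.comp ((of Γ G v).comp (proj Γ G v))
  have : f = f' := by
    refine hom_ext fun u g => ?_
    rw [MonoidHom.finsetProd_apply, Finset.prod_eq_single u]
    · simp
    · intro v _ hv
      simp [proj_of_ne hv]
    · simp
  conv_lhs => rw [this, MonoidHom.finsetProd_apply]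
  rfl

/-- An element of finite order is killed by the projection to one of any two nonadjacent
vertices. -/
theorem proj_eq_one_or_of_isOfFinOrder {g : GraphProduct Γ G} (hg : IsOfFinOrder g) {s t : V}
    (hst : s ≠ t) (hadj : ¬ Γ.Adj s t) : proj Γ G s g = 1 ∨ proj Γ G t g = 1 := by
  classical
  -- Killing every vertex group but those at `s` and `t` respects the relators, because `s` and `t`
  -- are not adjacent.
  let φ : GraphProduct Γ G →* Monoid.CoprodI G :=
    lift (fun v => if v = s ∨ v = t then Monoid.CoprodI.of else 1) (by
      intro u v huv g h
      by_cases hu : u = s ∨ u = t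
      · by_cases hv : v = s ∨ v = t
        · exfalso
          rcases hu with rfl | rfl <;> rcases hv with rfl | rfl
          · exact huv.ne rfl
          · exact hadj huv
          · exact hadj huv.symm
          · exact huv.ne rfl
        · simp [hv]
      · simp [hu])
  let π : ∀ v, Monoid.CoprodI G →* G v := fun v =>
    (Pi.evalMonoidHom G v).comp (Monoid.CoprodI.lift fun v => MonoidHom.mulSingle G v)
  have hπ : ∀ v, v = s ∨ v = t → π v (φ g) = proj Γ G v g := by
    intro v hv
    have : (π v).comp φ = proj Γ G v := by
      refine hom_ext fun u h => ?_
      rcases eq_or_ne v u with rfl | huv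
      · simp [π, φ, hv]
      · rw [proj_of_ne huv]
        by_cases hu : u = s ∨ u = t <;> simp [π, φ, hu, huv]
    rw [← this]
    rfl
  have hconj : ∀ v, ∀ c : Monoid.CoprodI G, IsConj (φ g) c → π v c = 1 → π v (φ g) = 1 := by
    intro v c hc h1
    have := (π v).map_isConj hc
    rwa [h1, isConj_one_left] at this
  obtain ⟨l, hl, hc⟩ := Monoid.CoprodI.exists_isConj_listProd_of_isOfFinOrder (φ.isOfFinOrder hg)
  match l, hl with
  | [], _ =>
    left
    rw [← hπ s (Or.inl rfl)]
    exact hconj s _ hc (map_one _)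
  | [a], _ =>
    have key : ∀ v, v = s ∨ v = t → v ≠ a.1 → proj Γ G v g = 1 := by
      intro v hv hva
      rw [← hπ v hv]
      refine hconj v _ hc ?_
      simp [π, Monoid.CoprodI.listProd, hva]
    rcases eq_or_ne s a.1 with rfl | hs
    · exact Or.inr (key t (Or.inr rfl) hst.symm)
    · exact Or.inl (key s (Or.inl rfl) hs)

/-- If commuting elements of finite order project nontrivially to the vertices `s` and `t`
respectively, then these are equal or adjacent. -/
theorem eq_or_adj_of_commute {f g : GraphProduct Γ G} (hf : IsOfFinOrder f) (hg : IsOfFinOrder g)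
    (hfg : Commute f g) {s t : V} (hs : proj Γ G s f ≠ 1) (ht : proj Γ G t g ≠ 1) :
    s = t ∨ Γ.Adj s t := by
  by_contra! h
  have h1 := (proj_eq_one_or_of_isOfFinOrder hf h.1 h.2).resolve_left hs
  have h2 := (proj_eq_one_or_of_isOfFinOrder hg h.1 h.2).resolve_right ht
  -- The product `f * g` is torsion too, yet it projects nontrivially to both `s` and `t`.
  rcases proj_eq_one_or_of_isOfFinOrder (hfg.isOfFinOrder_mul hf hg) h.1 h.2 with h3 | h3
  · rw [map_mul, h2, mul_one] at h3
    exact hs h3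
  · rw [map_mul, h1, one_mul] at h3
    exact ht h3

end GraphProduct

/-! ### Supports detected by projections -/

section Support

variable {x : ∀ v, G v}

theorem exists_wordValue_eq (hx : ∀ v, ∀ g : G v, g ∈ Subgroup.zpowers (x v))
    (g : GraphProduct Γ G) : ∃ w, wordValue Γ G x w = g := by
  have happ : ∀ w w', wordValue Γ G x (w ++ w') = wordValue Γ G x w * wordValue Γ G x w' :=
    fun w w' => by simp [wordValue]
  obtain ⟨g, rfl⟩ := QuotientGroup.mk_surjective g
  induction g using Monoid.CoprodI.induction_on with
  | one => exact ⟨[], rfl⟩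
  | of v h =>
    obtain ⟨z, rfl⟩ := Subgroup.mem_zpowers_iff.1 (hx v h)
    change ∃ w, wordValue Γ G x w = GraphProduct.of Γ G v (x v ^ z)
    obtain ⟨n, rfl | rfl⟩ := z.eq_nat_or_neg
    · exact ⟨List.replicate n (v, true), by simp [wordValue]⟩
    · exact ⟨List.replicate n (v, false), by simp [wordValue]⟩
  | mul g h hg hh =>
    obtain ⟨w, hw⟩ := hg
    obtain ⟨w', hw'⟩ := hh
    exact ⟨w ++ w', by rw [happ, hw, hw']; rfl⟩

theorem exists_isReducedWord (hx : ∀ v, ∀ g : G v, g ∈ Subgroup.zpowers (x v))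
    (g : GraphProduct Γ G) : ∃ w, IsReducedWord Γ G x w ∧ wordValue Γ G x w = g := by
  classical
  have hex : ∃ n, ∃ w, w.length = n ∧ wordValue Γ G x w = g := by
    obtain ⟨w, hw⟩ := exists_wordValue_eq (Γ := Γ) hx g
    exact ⟨_, w, rfl, hw⟩
  obtain ⟨w, hw, hwg⟩ := Nat.find_spec hex
  exact ⟨w, fun w' h' => hw ▸ Nat.find_min' hex ⟨w', rfl, h'.trans hwg⟩, hwg⟩

/-- Every word avoiding `v` projects trivially to `G v`. -/
theorem mem_support_of_proj_ne_one (hx : ∀ v, ∀ g : G v, g ∈ Subgroup.zpowers (x v))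
    {g : GraphProduct Γ G} {v : V} (h : GraphProduct.proj Γ G v g ≠ 1) :
    v ∈ support Γ G x g := by
  obtain ⟨w, hw, rfl⟩ := exists_isReducedWord (Γ := Γ) hx g
  refine ⟨w, hw, rfl, ?_⟩
  by_contra! hv
  refine h ?_
  rw [wordValue, map_list_prod]
  refine List.prod_eq_one fun a ha => ?_
  simp only [List.map_map, List.mem_map] at ha
  obtain ⟨⟨u, b⟩, hu, rfl⟩ := ha
  have huv : v ≠ u := by
    rintro rfl
    cases b
    · exact hv.2 hu
    · exact hv.1 hu
  cases b <;> simp [GraphProduct.proj_of_ne huv]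

theorem mem_cyclicSupport_of_proj_ne_one (hx : ∀ v, ∀ g : G v, g ∈ Subgroup.zpowers (x v))
    {g : GraphProduct Γ G} {v : V} (h : GraphProduct.proj Γ G v g ≠ 1) :
    v ∈ cyclicSupport Γ G x g := by
  intro a
  refine mem_support_of_proj_ne_one hx ?_
  rwa [map_mul, map_mul, map_inv, Ne, conj_eq_one_iff]

end Support

end GraphProd

/-! ### Linear algebra and cyclic groups modulo a prime -/

/-- A nonzero determinant has a nonzero term in its Leibniz expansion. -/
theorem exists_equiv_forall_ne_zero {A B K : Type*} [Fintype A] [Fintype B] [DecidableEq A]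
    [DecidableEq B] [Field K] {M : Matrix A B K} {N : Matrix B A K} (h : M * N = 1)
    (h' : N * M = 1) : ∃ e : A ≃ B, ∀ a, M a (e a) ≠ 0 := by
  have hcard : Fintype.card A = Fintype.card B := by
    have := (Matrix.toLin'OfInv h' h).finrank_eq
    simpa using this.symm
  let e := Fintype.equivOfCardEq hcard
  have hdet : (M.submatrix id e).det ≠ 0 := by
    have hmul : M.submatrix id e * N.submatrix e id = 1 := by
      rw [Matrix.submatrix_mul_equiv, h, Matrix.submatrix_id_id]
    intro h0
    have := congrArg Matrix.det hmul
    rw [Matrix.det_mul, h0, zero_mul, Matrix.det_one] at this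
    exact zero_ne_one this
  rw [Matrix.det_apply] at hdet
  obtain ⟨σ, -, hσ⟩ := Finset.exists_ne_zero_of_sum_ne_zero hdet
  have hσ' : ∏ i, M.submatrix id e (σ i) i ≠ 0 := fun h0 => hσ (by rw [h0, smul_zero])
  rw [Finset.prod_ne_zero_iff] at hσ'
  refine ⟨σ.symm.trans e, fun a => ?_⟩
  simpa using hσ' (σ.symm a) (Finset.mem_univ _)

theorem exists_eq_pow_of_pow_eq_one {G : Type*} [Group G] {x : G}
    (hx : ∀ g, g ∈ Subgroup.zpowers x) {p k j : ℕ} (hp : p.Prime) (hc : Nat.card G = p ^ k)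
    (hjk : j < k) {h : G} (hh : h ^ p ^ j = 1) : ∃ z, h = z ^ p := by
  obtain ⟨a, rfl⟩ := Subgroup.mem_zpowers_iff.1 (hx h)
  rw [← zpow_natCast, ← zpow_mul, ← orderOf_dvd_iff_zpow_eq_one,
    orderOf_eq_card_of_forall_mem_zpowers hx, hc] at hh
  have h1 : ((p ^ (j + 1) : ℕ) : ℤ) ∣ a * (p ^ j : ℕ) :=
    (Int.natCast_dvd_natCast.2 (pow_dvd_pow p hjk)).trans hh
  have hpj : ((p ^ j : ℕ) : ℤ) ≠ 0 := by exact_mod_cast (pow_pos hp.pos j).ne'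
  rw [pow_succ', Nat.cast_mul] at h1
  obtain ⟨b, rfl⟩ := Int.dvd_of_mul_dvd_mul_right hpj h1
  exact ⟨x ^ b, by rw [← zpow_natCast, ← zpow_mul, mul_comm]⟩

theorem map_pow_eq_one {G : Type*} [Group G] {p : ℕ} (f : G →* Multiplicative (ZMod p)) (z : G) :
    f (z ^ p) = 1 := by
  rw [map_pow]
  apply Multiplicative.toAdd.injective
  simp

/-- A homomorphism between cyclic groups of distinct prime power orders `q ^ j` and `p ^ k` kills,
modulo `p`, every element whose order divides `p ^ k`. -/
theorem map_map_eq_one_of_card_ne {G H : Type*} [Group G] [Group H] {x : G} {y : H}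
    (hx : ∀ g, g ∈ Subgroup.zpowers x) (hy : ∀ h, h ∈ Subgroup.zpowers y) {p k : ℕ}
    (hp : p.Prime) (hG : Nat.card G = p ^ k) (hH : IsPrimePow (Nat.card H))
    (hne : Nat.card H ≠ p ^ k) (l : G →* Multiplicative (ZMod p)) (f : H →* G) {h : H}
    (hh : h ^ p ^ k = 1) : l (f h) = 1 := by
  obtain ⟨q, j, hq, -, hqj⟩ := (isPrimePow_nat_iff _).1 hH
  have hhq : h ^ q ^ j = 1 := by rw [hqj, pow_card_eq_one']
  rcases eq_or_ne q p with rfl | hqp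
  -- If `j < k`, then `f h` is a `p`-th power in `G`; if `j > k`, then `h` is already one in `H`.
  -- Either way `l` kills it.
  · rcases lt_trichotomy j k with hjk | rfl | hjk
    · obtain ⟨z, hz⟩ := exists_eq_pow_of_pow_eq_one hx hp hG hjk (h := f h)
        (by rw [← map_pow, hhq, map_one])
      rw [hz, map_pow_eq_one]
    · exact absurd hqj.symm hne
    · obtain ⟨z, rfl⟩ := exists_eq_pow_of_pow_eq_one hy hp hqj.symm hjk hh
      exact map_pow_eq_one (l.comp f) z
  · have : orderOf h = 1 := Nat.eq_one_of_dvd_coprimes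
      (Nat.Coprime.pow j k ((Nat.coprime_primes hq hp).2 hqp))
      (orderOf_dvd_of_pow_eq_one hhq) (orderOf_dvd_of_pow_eq_one hh)
    rw [orderOf_eq_one_iff.1 this, map_one, map_one]

theorem exists_hom_zmod {G : Type*} [Group G] {x : G} (hx : ∀ g, g ∈ Subgroup.zpowers x)
    {p : ℕ} (hp : p ∣ Nat.card G) :
    ∃ l : G →* Multiplicative (ZMod p), l x = Multiplicative.ofAdd 1 := by
  refine ⟨monoidHomOfForallMemZpowers hx (g' := Multiplicative.ofAdd 1) ?_,
    monoidHomOfForallMemZpowers_apply_gen _ _⟩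
  rw [orderOf_eq_card_of_forall_mem_zpowers hx, orderOf_ofAdd_eq_addOrderOf, ZMod.addOrderOf_one]
  exact hp

/-- The permutation `t' ∘ t` has finite order, so `t⁻¹` is a power of it composed with `t'`, hence
preserves adjacency. -/
theorem SimpleGraph.adj_of_adj_map_of_equiv {V W : Type*} [Finite V] {Γ : SimpleGraph V}
    {Δ : SimpleGraph W} (t : V ≃ W) (t' : W ≃ V) (ht : ∀ u v, Γ.Adj u v → Δ.Adj (t u) (t v))
    (ht' : ∀ u v, Δ.Adj u v → Γ.Adj (t' u) (t' v)) {u v : V} (h : Δ.Adj (t u) (t v)) :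
    Γ.Adj u v := by
  let σ : Equiv.Perm V := t.trans t'
  have hσ : ∀ n : ℕ, ∀ a b, Γ.Adj a b → Γ.Adj ((σ ^ n) a) ((σ ^ n) b) := by
    intro n
    induction n with
    | zero => exact fun _ _ h => h
    | succ n ih =>
      intro a b hab
      rw [pow_succ]
      exact ih _ _ (ht' _ _ (ht _ _ hab))
  obtain ⟨n, hn, h1⟩ := isOfFinOrder_iff_pow_eq_one.1 (isOfFinOrder_of_finite σ)
  obtain ⟨m, rfl⟩ := Nat.exists_eq_add_of_lt hn
  have h2 := hσ m _ _ (ht' _ _ h)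
  rw [Nat.zero_add, pow_succ] at h1
  have h3 : ∀ a, (σ ^ m) (t' (t a)) = a := fun a => DFunLike.congr_fun h1 a
  rwa [h3, h3] at h2

/-! ### The bijection of vertices -/

namespace GraphProd

open GraphProduct

variable {V W : Type*} {Γ : SimpleGraph V} {Δ : SimpleGraph W}
  {G : V → Type*} [∀ v, Group (G v)] {H : W → Type*} [∀ w, Group (H w)]
  {x : ∀ v, G v} {y : ∀ w, H w}

/-- The matrix modulo `p`, over the vertices whose groups have order `n`, of the map induced by
a homomorphism of graph products on the products of the vertex groups. -/
noncomputable def blockMatrix (x : ∀ v, G v) {p n : ℕ}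
    (m : ∀ s : {s // Nat.card (H s) = n}, H s →* Multiplicative (ZMod p))
    (f : GraphProduct Γ G →* GraphProduct Δ H) :
    Matrix {u // Nat.card (G u) = n} {s // Nat.card (H s) = n} (ZMod p) :=
  fun u s => (m s (proj Δ H s (f (of Γ G u (x u))))).toAdd

theorem blockMatrix_mul_eq_one [Fintype W] [DecidableEq V]
    (hx : ∀ v, ∀ g : G v, g ∈ Subgroup.zpowers (x v))
    (hy : ∀ w, ∀ h : H w, h ∈ Subgroup.zpowers (y w))
    (hH : ∀ w, IsPrimePow (Nat.card (H w))) {p k : ℕ} (hp : p.Prime)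
    (l : ∀ u : {u // Nat.card (G u) = p ^ k}, G u →* Multiplicative (ZMod p))
    (hl : ∀ u, l u (x u) = Multiplicative.ofAdd 1)
    (m : ∀ s : {s // Nat.card (H s) = p ^ k}, H s →* Multiplicative (ZMod p))
    (hm : ∀ s, m s (y s) = Multiplicative.ofAdd 1)
    (f : GraphProduct Γ G →* GraphProduct Δ H) (f' : GraphProduct Δ H →* GraphProduct Γ G)
    (hff' : ∀ g, f' (f g) = g) :
    blockMatrix x m f * blockMatrix y l f' = 1 := by
  classical
  ext u v
  -- The target is commutative, so the value at `f' (f u) = u` splits over the vertices of `Δ`;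
  -- those of order `p ^ k` give the matrix product and the others vanish.
  have key := map_eq_prod_proj ((l v).comp ((proj Γ G v).comp f')) (f (of Γ G u (x u)))
  simp only [MonoidHom.comp_apply, hff'] at key
  have key' := congrArg Multiplicative.toAdd key
  rw [toAdd_prod] at key'
  rw [Matrix.mul_apply]
  trans ((l v) (proj Γ G v (of Γ G u (x u)))).toAdd
  · rw [key']
    symm
    refine Finset.sum_congr_set {s | Nat.card (H s) = p ^ k} _ _ ?_ ?_
    · intro s hs
      obtain ⟨z, hz⟩ := Subgroup.mem_zpowers_iff.1 (hy s (proj Δ H s (f (of Γ G u (x u)))))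
      have hms : (m ⟨s, hs⟩) (y s) = Multiplicative.ofAdd 1 := hm ⟨s, hs⟩
      simp only [blockMatrix, ← hz, map_zpow, hms, toAdd_zpow, toAdd_ofAdd, zsmul_eq_mul, mul_one]
    · intro s hs
      have h1 : proj Δ H s (f (of Γ G u (x u))) ^ p ^ k = 1 := by
        have hu : x u ^ p ^ k = 1 :=
          orderOf_dvd_iff_pow_eq_one.1 ((orderOf_dvd_natCard _).trans u.2.dvd)
        rw [← map_pow, ← map_pow, ← map_pow, hu, map_one, map_one, map_one]
      have h2 := map_map_eq_one_of_card_ne (hx v) (hy s) hp v.2 (hH s) hs (l v)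
        ((proj Γ G v).comp (f'.comp (of Δ H s))) h1
      exact congrArg Multiplicative.toAdd h2
  · rcases eq_or_ne u v with rfl | huv
    · rw [proj_of_self, hl, Matrix.one_apply_eq, toAdd_ofAdd]
    · rw [proj_of_ne (fun h => huv (Subtype.ext h.symm)), map_one, Matrix.one_apply_ne huv,
        toAdd_one]

theorem exists_equiv_card_eq [Finite V] [Finite W] (hG : ∀ v, IsPrimePow (Nat.card (G v)))
    (hH : ∀ w, IsPrimePow (Nat.card (H w)))
    (hx : ∀ v, ∀ g : G v, g ∈ Subgroup.zpowers (x v))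
    (hy : ∀ w, ∀ h : H w, h ∈ Subgroup.zpowers (y w))
    (τ : GraphProduct Γ G ≃* GraphProduct Δ H) (n : ℕ) :
    ∃ e : {u // Nat.card (G u) = n} ≃ {s // Nat.card (H s) = n},
      ∀ u, proj Δ H (e u) (τ (of Γ G u (x u))) ≠ 1 := by
  classical
  have := Fintype.ofFinite V
  have := Fintype.ofFinite W
  by_cases hn : IsPrimePow n
  · obtain ⟨p, k, hp, hk, rfl⟩ := (isPrimePow_nat_iff _).1 hn
    have := Fact.mk hp
    have hl : ∀ u : {u // Nat.card (G u) = p ^ k}, ∃ l : G u →* Multiplicative (ZMod p),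
        l (x u) = Multiplicative.ofAdd 1 :=
      fun u => exists_hom_zmod (hx u) ((dvd_pow_self p hk.ne').trans u.2.symm.dvd)
    have hm : ∀ s : {s // Nat.card (H s) = p ^ k}, ∃ m : H s →* Multiplicative (ZMod p),
        m (y s) = Multiplicative.ofAdd 1 :=
      fun s => exists_hom_zmod (hy s) ((dvd_pow_self p hk.ne').trans s.2.symm.dvd)
    choose l hl using hl
    choose m hm using hm
    obtain ⟨e, he⟩ := exists_equiv_forall_ne_zero
      (blockMatrix_mul_eq_one hx hy hH hp l hl m hm τ.toMonoidHom τ.symm.toMonoidHom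
        τ.symm_apply_apply)
      (blockMatrix_mul_eq_one hy hx hG hp m hm l hl τ.symm.toMonoidHom τ.toMonoidHom
        τ.apply_symm_apply)
    refine ⟨e, fun u h => he u ?_⟩
    have : (m (e u) (proj Δ H (e u) (τ (of Γ G u (x u))))).toAdd = 0 := by
      rw [h, map_one, toAdd_one]
    exact this
  · have : IsEmpty {u // Nat.card (G u) = n} := ⟨fun u => hn (u.2 ▸ hG u)⟩
    have : IsEmpty {s // Nat.card (H s) = n} := ⟨fun s => hn (s.2 ▸ hH s)⟩
    exact ⟨Equiv.equivOfIsEmpty _ _, isEmptyElim⟩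

theorem exists_equiv_proj_ne_one [Finite V] [Finite W] (hG : ∀ v, IsPrimePow (Nat.card (G v)))
    (hH : ∀ w, IsPrimePow (Nat.card (H w)))
    (hx : ∀ v, ∀ g : G v, g ∈ Subgroup.zpowers (x v))
    (hy : ∀ w, ∀ h : H w, h ∈ Subgroup.zpowers (y w))
    (τ : GraphProduct Γ G ≃* GraphProduct Δ H) :
    ∃ t : V ≃ W, (∀ u, Nat.card (H (t u)) = Nat.card (G u)) ∧
      ∀ u, proj Δ H (t u) (τ (of Γ G u (x u))) ≠ 1 := by
  choose e he using exists_equiv_card_eq hG hH hx hy τ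
  exact ⟨Equiv.ofFiberEquiv e, fun u => Equiv.ofFiberEquiv_map e u, fun u => he _ ⟨u, rfl⟩⟩

/-- A bijection of the vertices that picks out nontrivial projections preserves adjacency. -/
theorem adj_of_proj_ne_one (hG : ∀ v, IsPrimePow (Nat.card (G v)))
    (τ : GraphProduct Γ G ≃* GraphProduct Δ H) (t : V ≃ W)
    (ht : ∀ u, proj Δ H (t u) (τ (of Γ G u (x u))) ≠ 1) (u v : V) (huv : Γ.Adj u v) :
    Δ.Adj (t u) (t v) := by
  have hfin : ∀ u, IsOfFinOrder (τ (of Γ G u (x u))) := by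
    intro u
    have := Nat.finite_of_card_ne_zero (hG u).ne_zero
    exact τ.toMonoidHom.isOfFinOrder ((of Γ G u).isOfFinOrder (isOfFinOrder_of_finite (x u)))
  exact (eq_or_adj_of_commute (hfin u) (hfin v) ((commute_of huv _ _).map τ) (ht u)
    (ht v)).resolve_left (t.injective.ne huv.ne)

end GraphProd

theorem theorem4p4 {V W : Type*} [Finite V] [Finite W]
    (Γ : SimpleGraph V) (Δ : SimpleGraph W)
    (G : V → Type*) [∀ v, Group (G v)] (H : W → Type*) [∀ w, Group (H w)]
    -- the vertex groups are primary: they have prime-power order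
    (hG : ∀ v, IsPrimePow (Nat.card (G v))) (hH : ∀ w, IsPrimePow (Nat.card (H w)))
    -- the vertex groups are cyclic, with generators `x v` and `y w`
    (x : ∀ v, G v) (hx : ∀ v, ∀ g : G v, g ∈ Subgroup.zpowers (x v))
    (y : ∀ w, H w) (hy : ∀ w, ∀ h : H w, h ∈ Subgroup.zpowers (y w))
    (τ : GraphProd.GraphProduct Γ G ≃* GraphProd.GraphProduct Δ H) :
    ∃ t : Γ ≃g Δ, (∀ u : V, Nonempty (G u ≃* H (t u))) ∧
      ∀ u : V, t u ∈ GraphProd.cyclicSupport Δ H y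
        (τ (GraphProd.GraphProduct.of Γ G u (x u))) := by
  obtain ⟨t, htc, ht⟩ := GraphProd.exists_equiv_proj_ne_one hG hH hx hy τ
  obtain ⟨t', -, ht'⟩ := GraphProd.exists_equiv_proj_ne_one hH hG hy hx τ.symm
  have hadj := GraphProd.adj_of_proj_ne_one hG τ t ht
  have hadj' := GraphProd.adj_of_proj_ne_one hH τ.symm t' ht'
  refine ⟨⟨t, ⟨SimpleGraph.adj_of_adj_map_of_equiv t t' hadj hadj', hadj _ _⟩⟩, fun u => ?_,
    fun u => GraphProd.mem_cyclicSupport_of_proj_ne_one hy (ht u)⟩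
  have : IsCyclic (G u) := ⟨x u, hx u⟩
  have : IsCyclic (H (t u)) := ⟨y (t u), hy (t u)⟩
  exact ⟨mulEquivOfCyclicCardEq (htc u).symm⟩
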